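/- Let $p$ be a prime, $n\ge 0$, and let $e=(e_1,\dots,e_n)$ be integers with $1\le e_1\le e_2\le\dots\le e_n$. Let $P$ be a finite abelian $p$-group of type $e$, that is, $P\cong\bigoplus_{i=1}^n \mathbb{Z}/p^{e_i}\mathbb{Z}$. For $i\in\{1,\dots,p-1\}$ let $\mu_i$ be the automorphism $x\mapsto ix$ of $P$, and for $\varphi\in\operatorname{Aut}(P)$ put $\Pi(\varphi)=\prod_{i=1}^{p-1}|\operatorname{Fix}(\mu_i\circ\varphi)|$, where $\operatorname{Fix}(\psi)=\{x\in P:\psi(x)=x\}$. Decompose the sequence $e$ into blocks as follows. (1) Each maximal constant subsequence $e_i=e_{i+1}=\dots=e_j$ of length at least $2$ forms an $a$-block. (2) Among the remaining entries, starting from the left, successive entries $e_i,e_{i+1}$ with $e_{i+1}=e_i+1$ are paired, each entry being used at most once; each such pair forms a $b$-block. (3) Each entry that then still remains forms a $c$-block by itself. Let $b(e)$ and $c(e)$ be the numbers of $b$-blocks and $c$-blocks, and let $\Sigma(e)=\sum_{i=1}^n e_i$. Then $$\{\Pi(\varphi) : \varphi\in\operatorname{Aut}(P)\}=\{p^m :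 m\in\mathbb{Z},\ b(e)+c(e)\le m\le \Sigma(e)\}.$$ -/

import Mathlib

namespace AbelianPGroup

/-- `E n`: the non-decreasing `n`-tuples of positive integers. -/
def E (n : ℕ) : Set (Fin n → ℕ) := {e | (∀ i, 1 ≤ e i) ∧ Monotone e}

/-- The abelian `p`-group `⨁ᵢ ℤ / p ^ eᵢ ℤ` attached to the tuple `e`. -/
abbrev StdGroup (p : ℕ) {n : ℕ} (e : Fin n → ℕ) : Type := ∀ i : Fin n, ZMod (p ^ e i)

/-- `P` is a finite abelian `p`-group of type `e`. -/
def IsOfType (p : ℕ) {n : ℕ} (e : Fin n → ℕ) (P : Type*) [AddCommGroup P] : Prop :=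
  e ∈ E n ∧ Nonempty (P ≃+ StdGroup p e)

section FixedPoints

variable (p : ℕ) (P : Type*) [AddCommGroup P]

variable {P} in
/-- `Π(φ) = ∏_{i = 1}^{p - 1} |Fix (μᵢ ∘ φ)|`, where `μᵢ x = i x`. -/
noncomputable def prodFix (φ : P ≃+ P) : ℕ :=
  ∏ i ∈ Finset.Icc 1 (p - 1),
    Nat.card (Function.fixedPoints (⇑(nsmulAddMonoidHom i : P →+ P) ∘ ⇑φ))

/-- The set of values of `Π` over all automorphisms of `P`. -/
def prodSpec : Set ℕ := Set.range fun φ : P ≃+ P => prodFix p φ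

end FixedPoints

section Decomposition

variable {n : ℕ} (e : Fin n → ℕ)

/-- The index `i` lies in an `a`-block. For non-decreasing `e` the indices of one value are
consecutive, so the maximal constant subsequences of length at least two are exactly the sets
of indices of the values that occur at least twice. -/
def InA (i : Fin n) : Prop := ∃ j, j ≠ i ∧ e j = e i

/-- The entries at positions `k` and `k + 1` (counted from `0`) both exist, lie in no `a`-block,
and the second is one more than the first. -/
def IsBCandidate (k : ℕ) : Prop :=
  ∃ h : k + 1 < n, ¬ InA e ⟨k, k.lt_of_succ_lt h⟩ ∧ ¬ InA e ⟨k + 1, h⟩ ∧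
    e ⟨k + 1, h⟩ = e ⟨k, k.lt_of_succ_lt h⟩ + 1

/-- Position `k` is the first position of a `b`-block. Pairs are formed from the left: a candidate
pair is taken unless its first entry has just been used as the second entry of a pair. -/
def IsBStart : ℕ → Prop
  | 0 => IsBCandidate e 0
  | k + 1 => IsBCandidate e (k + 1) ∧ ¬ IsBStart k

/-- The index `i` lies in a `b`-block, as its first or as its second entry. -/
def InB (i : Fin n) : Prop := IsBStart e i ∨ ∃ k, k + 1 = (i : ℕ) ∧ IsBStart e k

/-- The number `b(e)` of `b`-blocks, counted by their first entries. -/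
noncomputable def bCount : ℕ := Nat.card {i : Fin n // IsBStart e i}

/-- The number `c(e)` of `c`-blocks: the entries in no `a`-block and no `b`-block. -/
noncomputable def cCount : ℕ := Nat.card {i : Fin n // ¬ InA e i ∧ ¬ InB e i}

end Decomposition

end AbelianPGroup

/-!
Since `k φ(x) = x` says that `φ⁻¹` has the eigenvector `x` with eigenvalue `k`, the number `Π(φ)` is
the product of the sizes of the eigenspaces of `φ⁻¹` for `1, …, p - 1`. These eigenvalues differ by
units, so the eigenspaces are independent and `Π(φ)` divides `|P| = p ^ Σ(e)`.

For the lower bound, let `T` consist of the first entries of the `b`-blocks and of the `c`-entries.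
The values of `e` on `T` are isolated, so the diagonal entry of `φ⁻¹` at each `t ∈ T` is a unit,
congruent to some `k ∈ {1, …, p - 1}`. If `S` collects the `t` belonging to one `k`, then
`φ⁻¹ - k` maps the vectors with `i`-th entry divisible by `p ^ #{t ∈ S | e t < e i}` to those with
`i`-th entry divisible by `p ^ #{t ∈ S | e t ≤ e i}`. The latter are fewer by the factor `p ^ #S`,
which therefore bounds the size of the `k`-eigenspace from below.

Conversely, `Π` is multiplicative over direct sums, so each block can be treated by itself. If `ν`
is nilpotent then `1 + ν` is an automorphism with only the eigenvalue `1` among `1, …, p - 1`, and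
its eigenspace is the kernel of `ν`. The choice `ν = p ^ s` gives the values `p, …, p ^ a` on
`ℤ / p ^ a ℤ`, and maps between the two summands of a `b`-block whose composites are multiplication
by `p` give the value `p`. On an `a`-block, an endomorphism whose characteristic polynomial has no
root modulo `p` has no eigenvalues and gives the value `1`.
-/

namespace AbelianPGroup

open Finset Module

section Transfer

variable (p : ℕ) {P Q : Type*} [AddCommGroup P] [AddCommGroup Q]

section Eigenspace

variable {R : Type*} [CommRing R] [Module R P]

lemma prodFix_eq_prod_card_eigenspace (φ : P ≃+ P) (ψ : End R P) (hψ : ∀ x, ψ (φ x) = x) :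
    prodFix p φ = ∏ k ∈ Icc 1 (p - 1), Nat.card (ψ.eigenspace (k : R)) := by
  refine prod_congr rfl fun k _ => Nat.card_congr (φ.toEquiv.subtypeEquiv fun x => ?_)
  change k • φ x = x ↔ φ x ∈ ψ.eigenspace (k : R)
  rw [End.mem_eigenspace_iff, Nat.cast_smul_eq_nsmul, hψ, eq_comm]

lemma prod_card_eigenspace_mem_prodSpec {ψ : End R P} (hψ : IsUnit ψ) :
    ∏ k ∈ Icc 1 (p - 1), Nat.card (ψ.eigenspace (k : R)) ∈ prodSpec p P := by
  let ψ' := LinearEquiv.ofBijective ψ ((End.isUnit_iff ψ).mp hψ)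
  exact ⟨ψ'.symm.toAddEquiv, prodFix_eq_prod_card_eigenspace p _ ψ ψ'.apply_symm_apply⟩

end Eigenspace

lemma prodFix_conj (g : P ≃+ Q) (φ : P ≃+ P) :
    prodFix p ((g.symm.trans φ).trans g) = prodFix p φ := by
  refine prod_congr rfl fun k _ => (Nat.card_congr (g.toEquiv.subtypeEquiv fun x => ?_)).symm
  change k • φ x = x ↔ k • g (φ (g.symm (g x))) = g x
  rw [g.symm_apply_apply, ← map_nsmul g, g.injective.eq_iff]

lemma prodSpec_congr (g : P ≃+ Q) : prodSpec p P = prodSpec p Q :=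
  Set.Subset.antisymm (Set.range_subset_iff.mpr fun φ => ⟨_, prodFix_conj p g φ⟩)
    (Set.range_subset_iff.mpr fun φ => ⟨_, prodFix_conj p g.symm φ⟩)

lemma prodFix_prodCongr (φ : P ≃+ P) (θ : Q ≃+ Q) :
    prodFix p (φ.prodCongr θ) = prodFix p φ * prodFix p θ := by
  simp only [prodFix, ← prod_mul_distrib, ← Nat.card_prod]
  refine prod_congr rfl fun k _ => Nat.card_congr
    ((Equiv.subtypeEquivRight fun x => ?_).trans Equiv.subtypeProdEquivProd)
  exact Prod.ext_iff

lemma mul_mem_prodSpec_prod {a b : ℕ} (ha : a ∈ prodSpec p P) (hb : b ∈ prodSpec p Q) :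
    a * b ∈ prodSpec p (P × Q) := by
  obtain ⟨φ, rfl⟩ := ha
  obtain ⟨θ, rfl⟩ := hb
  exact ⟨_, prodFix_prodCongr p φ θ⟩

end Transfer

section UpperBound

lemma isUnit_intCast_of_isNilpotent {R : Type*} [Ring R] {p : ℕ} (hp : p.Prime)
    (hR : IsNilpotent (p : R)) {k : ℤ} (hk : ¬ (p : ℤ) ∣ k) : IsUnit (k : R) := by
  obtain ⟨N, hN⟩ := hR
  obtain ⟨a, b, hab⟩ : IsCoprime k ((p : ℤ) ^ N) :=
    (((Nat.prime_iff_prime_int.mp hp).coprime_iff_not_dvd.mpr hk).symm).pow_right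
  have hab' : (a : R) * k = 1 := by simpa [hN] using congrArg (Int.cast : ℤ → R) hab
  exact ((Int.cast_commute a (k : R)).isUnit_mul_iff.mp (hab' ▸ isUnit_one)).2

lemma isUnit_natCast_sub_natCast_of_lt {R : Type*} [Ring R] {p : ℕ} (hp : p.Prime)
    (hR : IsNilpotent (p : R)) {j k : ℕ} (hj : j < p) (hk : k < p) (hjk : j ≠ k) :
    IsUnit ((j : R) - k) := by
  have hdvd : ¬ (p : ℤ) ∣ j - k := fun h => by
    have := Int.eq_zero_of_abs_lt_dvd h (by rw [abs_lt]; omega)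
    omega
  simpa using isUnit_intCast_of_isNilpotent hp hR hdvd

variable {R M : Type*} [CommRing R] [AddCommGroup M] [Module R M]

lemma card_sup_of_disjoint {K L : Submodule R M} (h : Disjoint K L) :
    Nat.card (K ⊔ L : Submodule R M) = Nat.card K * Nat.card L := by
  have hinj : Function.Injective (K.subtype.coprod L.subtype) := by
    rw [← LinearMap.ker_eq_bot, LinearMap.ker_coprod_of_disjoint_range, K.ker_subtype,
      L.ker_subtype, Submodule.prod_bot]
    rwa [K.range_subtype, L.range_subtype]
  rw [Submodule.sup_eq_range, ← Nat.card_prod]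
  exact (Nat.card_congr (LinearEquiv.ofInjective _ hinj).toEquiv).symm

open Polynomial in
lemma prod_card_eigenspace_eq_card_ker_aeval {ι : Type*} (s : Finset ι) (a : ι → R)
    (ha : (s : Set ι).Pairwise fun i j => IsUnit (a i - a j)) (ψ : End R M) :
    ∏ i ∈ s, Nat.card (ψ.eigenspace (a i)) =
      Nat.card (aeval ψ (∏ i ∈ s, (X - C (a i)))).ker := by
  classical
  induction s using Finset.induction_on with
  | empty => simp [Module.End.one_eq_id]
  | insert i s hi ih =>
    rw [coe_insert, Set.pairwise_insert_of_notMem (mod_cast hi)] at ha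
    have hcop : IsCoprime (X - C (a i)) (∏ j ∈ s, (X - C (a j))) :=
      IsCoprime.prod_right fun j hj =>
        isCoprime_X_sub_C_of_isUnit_sub (ha.2 j (mem_coe.mpr hj)).1
    have hker : ψ.eigenspace (a i) = (aeval ψ (X - C (a i))).ker := by
      rw [End.eigenspace_def, aeval_sub, aeval_X, aeval_C,
        Algebra.algebraMap_eq_smul_one]
    rw [prod_insert hi, prod_insert hi, ih ha.1, hker,
      ← sup_ker_aeval_eq_ker_aeval_mul_of_coprime ψ hcop,
      card_sup_of_disjoint (disjoint_ker_aeval_of_isCoprime ψ hcop)]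

lemma prod_card_eigenspace_dvd_card {ι : Type*} (s : Finset ι) (a : ι → R)
    (ha : (s : Set ι).Pairwise fun i j => IsUnit (a i - a j)) (ψ : End R M) :
    ∏ i ∈ s, Nat.card (ψ.eigenspace (a i)) ∣ Nat.card M := by
  rw [prod_card_eigenspace_eq_card_ker_aeval s a ha]
  exact (LinearMap.ker _).toAddSubgroup.card_addSubgroup_dvd_card

lemma prodFix_dvd_card {p N : ℕ} (hp : p.Prime) {P : Type*} [AddCommGroup P]
    (hP : Nat.card P = p ^ N) (φ : P ≃+ P) : prodFix p φ ∣ Nat.card P := by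
  let _ : Module (ZMod (p ^ N)) P :=
    AddCommGroup.zmodModule fun x => by rw [← hP, card_nsmul_eq_zero']
  have hnil : IsNilpotent (p : ZMod (p ^ N)) := ⟨N, by rw [← Nat.cast_pow, ZMod.natCast_self]⟩
  rw [prodFix_eq_prod_card_eigenspace p φ (φ.symm.toAddMonoidHom.toZModLinearMap (p ^ N))
    φ.symm_apply_apply]
  refine prod_card_eigenspace_dvd_card _ _ (fun j hj k hk hjk => ?_) _
  rw [coe_Icc, Set.mem_Icc] at hj hk
  exact isUnit_natCast_sub_natCast_of_lt hp hnil (by omega) (by omega) hjk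

end UpperBound

/-- The group `⨁ᵢ ℤ / p ^ eᵢ ℤ` for an arbitrary index type: `StdGroup p e` is the case of
`Fin n`, and the blocks of `e` give the case of a subset of `Fin n`. -/
abbrev PiZMod (p : ℕ) {ι : Type*} (e : ι → ℕ) : Type _ := ∀ i, ZMod (p ^ e i)

lemma card_piZMod (p : ℕ) {ι : Type*} [Fintype ι] (e : ι → ℕ) :
    Nat.card (PiZMod p e) = p ^ ∑ i, e i := by
  rw [Nat.card_pi, ← prod_pow_eq_pow_sum]
  exact prod_congr rfl fun i _ => Nat.card_zmod _

section Divisibility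

variable {p : ℕ} [NeZero p]

lemma card_pow_dvd {a b : ℕ} (h : b ≤ a) :
    Nat.card {y : ZMod (p ^ a) // (p : ZMod (p ^ a)) ^ b ∣ y} = p ^ (a - b) := by
  have hmultiples (y : ZMod (p ^ a)) : (p : ZMod (p ^ a)) ^ b ∣ y ↔
      y ∈ AddSubgroup.zmultiples ((p ^ b : ℕ) : ZMod (p ^ a)) := by
    rw [AddSubgroup.mem_zmultiples_iff]
    constructor
    · rintro ⟨z, rfl⟩
      exact ⟨z.val, by simp [mul_comm]⟩
    · rintro ⟨k, rfl⟩
      exact ⟨k, by simp [mul_comm]⟩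
  rw [Nat.card_congr (Equiv.subtypeEquivRight hmultiples), Nat.card_zmultiples,
    ZMod.addOrderOf_coe _ (NeZero.ne _), Nat.gcd_eq_right (pow_dvd_pow p h),
    Nat.pow_div h (NeZero.pos p)]

lemma pow_dvd_of_pow_smul_eq_zero {a b : ℕ} {y : ZMod (p ^ a)} (h : p ^ b • y = 0) :
    (p : ZMod (p ^ a)) ^ (a - b) ∣ y := by
  have hdvd : p ^ a ∣ p ^ b * y.val := by
    rw [← ZMod.natCast_eq_zero_iff]
    simpa using h
  obtain ⟨c, hc⟩ : p ^ (a - b) ∣ y.val := by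
    rcases le_total a b with hab | hab
    · simp [Nat.sub_eq_zero_of_le hab]
    · refine Nat.dvd_of_mul_dvd_mul_left (NeZero.pos (p ^ b)) ?_
      rwa [← pow_add, Nat.add_sub_cancel' hab]
  exact ⟨c, by rw [← ZMod.natCast_zmod_val y, hc]; simp⟩

lemma map_eq_mul_map_one {a b : ℕ} (f : ZMod (p ^ b) →ₗ[ℤ] ZMod (p ^ a)) (x : ZMod (p ^ b)) :
    f x = x.val * f 1 := by
  rw [← nsmul_eq_mul, ← map_nsmul, nsmul_one, ZMod.natCast_zmod_val]

lemma pow_add_sub_dvd_map {a b c : ℕ} (f : ZMod (p ^ b) →ₗ[ℤ] ZMod (p ^ a)) {x : ZMod (p ^ b)}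
    (hx : (p : ZMod (p ^ b)) ^ c ∣ x) : (p : ZMod (p ^ a)) ^ (c + (a - b)) ∣ f x := by
  obtain ⟨z, rfl⟩ := hx
  have hz : (p : ZMod (p ^ a)) ^ (a - b) ∣ f z := by
    refine pow_dvd_of_pow_smul_eq_zero ?_
    rw [← map_nsmul, nsmul_eq_mul, ZMod.natCast_self, zero_mul, map_zero]
  have hf : f (p ^ c * z) = p ^ c * f z := by
    simpa using map_nsmul f (p ^ c) z
  rw [hf, pow_add]
  exact mul_dvd_mul_left _ hz

lemma exists_dvd_sub_natCast_of_not_dvd {a : ℕ} {x : ZMod (p ^ a)}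
    (hx : ¬ (p : ZMod (p ^ a)) ∣ x) : ∃ k ∈ Icc 1 (p - 1), (p : ZMod (p ^ a)) ∣ x - k := by
  have hdvd : (p : ZMod (p ^ a)) ∣ x - (x.val % p : ℕ) := by
    have hdiv : x = p * (x.val / p : ℕ) + (x.val % p : ℕ) := by
      rw [← Nat.cast_mul, ← Nat.cast_add, Nat.div_add_mod, ZMod.natCast_zmod_val]
    exact ⟨(x.val / p : ℕ), sub_eq_of_eq_add hdiv⟩
  refine ⟨x.val % p, ?_, hdvd⟩
  have hpos : x.val % p ≠ 0 := fun h => hx (by simpa [h] using hdvd)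
  have hlt := Nat.mod_lt x.val (NeZero.pos p)
  rw [mem_Icc]
  omega

end Divisibility

section LowerBound

variable {p : ℕ} {ι : Type*} {e : ι → ℕ}

/-- The matrix entry of an endomorphism of `⨁ᵢ ℤ / p ^ eᵢ ℤ` from the `j`-th to the `i`-th
summand. -/
def entry [DecidableEq ι] (ψ : End ℤ (PiZMod p e)) (i j : ι) :
    ZMod (p ^ e j) →ₗ[ℤ] ZMod (p ^ e i) :=
  LinearMap.proj i ∘ₗ ψ ∘ₗ LinearMap.single ℤ (fun i => ZMod (p ^ e i)) j

lemma apply_eq_sum_entry [Fintype ι] [DecidableEq ι] (ψ : End ℤ (PiZMod p e)) (x : PiZMod p e)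
    (i : ι) : ψ x i = ∑ j, entry ψ i j (x j) := by
  conv_lhs => rw [← Finset.univ_sum_single x, map_sum, Finset.sum_apply]
  rfl

/-- The vectors in `⨁ᵢ ℤ / p ^ eᵢ ℤ` whose `i`-th entry is divisible by `p ^ fᵢ`. -/
def divSubmodule (p : ℕ) (e f : ι → ℕ) : Submodule ℤ (PiZMod p e) where
  carrier := {x | ∀ i, (p : ZMod (p ^ e i)) ^ f i ∣ x i}
  zero_mem' _ := dvd_zero _
  add_mem' hx hy i := dvd_add (hx i) (hy i)
  smul_mem' c _ hx i := dvd_smul_of_dvd c (hx i)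

lemma card_divSubmodule [NeZero p] [Fintype ι] {f : ι → ℕ} (h : ∀ i, f i ≤ e i) :
    Nat.card (divSubmodule p e f) = p ^ ∑ i, (e i - f i) := by
  have hpi : Nat.card (divSubmodule p e f) =
      Nat.card (∀ i, {y : ZMod (p ^ e i) // (p : ZMod (p ^ e i)) ^ f i ∣ y}) :=
    Nat.card_congr (Equiv.subtypePiEquivPi
      (p := fun {i} (y : ZMod (p ^ e i)) => (p : ZMod (p ^ e i)) ^ f i ∣ y))
  rw [hpi, Nat.card_pi, ← prod_pow_eq_pow_sum]
  exact prod_congr rfl fun i _ => card_pow_dvd (h i)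

lemma card_ker_mul_card_range {R M N : Type*} [Ring R] [AddCommGroup M] [AddCommGroup N]
    [Module R M] [Module R N] (ψ : M →ₗ[R] N) :
    Nat.card ψ.ker * Nat.card ψ.range = Nat.card M := by
  rw [ψ.ker.card_eq_card_quotient_mul_card, Nat.card_congr ψ.quotKerEquivRange.toEquiv]

lemma card_le_card_ker_mul {R M N : Type*} [Ring R] [AddCommGroup M] [AddCommGroup N] [Module R M]
    [Module R N] [Finite M] [Finite N] (ψ : M →ₗ[R] N) {H : Submodule R M} {K : Submodule R N}
    (h : ∀ x ∈ H, ψ x ∈ K) : Nat.card H ≤ Nat.card ψ.ker * Nat.card K := by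
  rw [← card_ker_mul_card_range (ψ.domRestrict H)]
  refine Nat.mul_le_mul (Nat.card_le_card_of_injective
    (fun x : (ψ.domRestrict H).ker => (⟨x.1, x.2⟩ : ψ.ker)) fun x y hxy => ?_) ?_
  · exact Subtype.ext (Subtype.ext (Subtype.mk.inj hxy))
  · refine Nat.card_mono (Set.toFinite _) ?_
    rintro _ ⟨x, rfl⟩
    exact h x x.2

/-- The values of `e` on `T` are attained nowhere else, and no two of them are consecutive.
The `b`-starts and the `c`-entries of a sequence form such a set. -/
structure Spaced (e : ι → ℕ) (T : Finset ι) : Prop where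
  eq_of_eq : ∀ ⦃j t⦄, t ∈ T → e j = e t → j = t
  ne_succ : ∀ ⦃s t⦄, s ∈ T → t ∈ T → e s ≠ e t + 1

namespace Spaced

variable {T : Finset ι}

lemma mono {S : Finset ι} (hT : Spaced e T) (h : S ⊆ T) : Spaced e S :=
  ⟨fun _ _ ht => hT.eq_of_eq (h ht), fun _ _ hs ht => hT.ne_succ (h hs) (h ht)⟩

lemma injOn (hT : Spaced e T) : Set.InjOn e T := fun _ _ _ ht h => hT.eq_of_eq ht h

lemma card_filter_le_le (hT : Spaced e T) (he : ∀ t ∈ T, 1 ≤ e t) (b : ℕ) :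
    #{t ∈ T | e t ≤ b} ≤ b := by
  calc #{t ∈ T | e t ≤ b} ≤ #(Icc 1 b) :=
        card_le_card_of_injOn e (fun t ht => by
            have ht := mem_filter.mp ht
            exact mem_Icc.mpr ⟨he t ht.1, ht.2⟩)
          (hT.injOn.mono (filter_subset _ _))
    _ = b := Nat.card_Icc 1 b

lemma card_filter_Icc_le (hT : Spaced e T) {i j : ι} (h : j = i → i ∉ T) :
    #{t ∈ T | e j ≤ e t ∧ e t ≤ e i} ≤ e i - e j := by
  classical
  have hinj : Set.InjOn e ({t ∈ T | e j ≤ e t ∧ e t ≤ e i} : Finset ι) :=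
    hT.injOn.mono (filter_subset _ _)
  rw [← card_image_of_injOn hinj]
  set V := ({t ∈ T | e j ≤ e t ∧ e t ≤ e i} : Finset ι).image e
  have hmem {v : ℕ} (hv : v ∈ V) : ∃ t ∈ T, e t = v := by
    obtain ⟨t, ht, rfl⟩ := mem_image.mp hv
    exact ⟨t, (mem_filter.mp ht).1, rfl⟩
  have hsub : V ⊆ Icc (e j) (e i) := image_subset_iff.mpr fun t ht =>
    mem_Icc.mpr (mem_filter.mp ht).2
  rcases lt_or_ge (e i) (e j) with hij | hji
  · rw [Icc_eq_empty_of_lt hij, subset_empty] at hsub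
    simp [hsub]
  have hgap : V ≠ Icc (e j) (e i) := fun hall => by
    obtain ⟨s, hs, hsi⟩ := hmem (hall ▸ right_mem_Icc.mpr hji)
    obtain rfl := hT.eq_of_eq hs hsi.symm
    rcases hji.eq_or_lt with heq | hlt
    · exact h (hT.eq_of_eq hs heq) hs
    · obtain ⟨t, ht, hti⟩ := hmem (v := e i - 1) (hall ▸ mem_Icc.mpr (by omega))
      exact hT.ne_succ hs ht (by omega)
  have := card_lt_card (hsub.ssubset_of_ne hgap)
  rw [Nat.card_Icc] at this
  omega

lemma card_filter_le_le_card_filter_lt_add (hT : Spaced e T) {i j : ι} (h : j = i → i ∉ T) :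
    #{t ∈ T | e t ≤ e i} ≤ #{t ∈ T | e t < e j} + (e i - e j) := by
  classical
  calc #{t ∈ T | e t ≤ e i}
      ≤ #({t ∈ T | e t < e j} ∪ {t ∈ T | e j ≤ e t ∧ e t ≤ e i}) := by
        refine card_le_card fun t ht => ?_
        simp only [mem_union, mem_filter] at ht ⊢
        grind
    _ ≤ #{t ∈ T | e t < e j} + #{t ∈ T | e j ≤ e t ∧ e t ≤ e i} := card_union_le _ _
    _ ≤ #{t ∈ T | e t < e j} + (e i - e j) := Nat.add_le_add_left (hT.card_filter_Icc_le h) _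

lemma card_filter_le_eq [DecidableEq ι] (hT : Spaced e T) (i : ι) :
    #{t ∈ T | e t ≤ e i} = #{t ∈ T | e t < e i} + if i ∈ T then 1 else 0 := by
  have hsingle : ({t ∈ T | e t = e i} : Finset ι) = if i ∈ T then {i} else ∅ := by
    have heq := hT.eq_of_eq
    ext t
    split_ifs <;> simp only [mem_filter, mem_singleton, notMem_empty, iff_false] <;> grind
  have hunion : ({t ∈ T | e t ≤ e i} : Finset ι) =
      {t ∈ T | e t < e i} ∪ {t ∈ T | e t = e i} := by
    rw [← filter_or]
    exact filter_congr fun t _ => le_iff_lt_or_eq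
  rw [hunion, card_union_of_disjoint (disjoint_filter.mpr fun t _ h => h.ne), hsingle]
  split_ifs <;> simp

end Spaced

variable [NeZero p] [Finite ι] {T : Finset ι}

/- The weight of `i` counts the `t ∈ T` with `e t` below `e i`. It grows from `j` to `i` by at most
the factor `p ^ (e i - e j)` that an entry supplies anyway, except on the diagonal at `T`, where
the hypothesis supplies the missing `p`. -/
lemma map_mem_divSubmodule [DecidableEq ι] (hT : Spaced e T) (ψ : End ℤ (PiZMod p e))
    (hψ : ∀ t ∈ T, (p : ZMod (p ^ e t)) ∣ entry ψ t t 1) {x : PiZMod p e}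
    (hx : x ∈ divSubmodule p e fun i => #{t ∈ T | e t < e i}) :
    ψ x ∈ divSubmodule p e fun i => #{t ∈ T | e t ≤ e i} := fun i => by
  cases nonempty_fintype ι
  rw [apply_eq_sum_entry]
  refine dvd_sum fun j _ => ?_
  by_cases hij : j = i → i ∉ T
  · exact (pow_dvd_pow _ (hT.card_filter_le_le_card_filter_lt_add hij)).trans
      (pow_add_sub_dvd_map _ (hx j))
  · push Not at hij
    obtain ⟨rfl, hj⟩ := hij
    have hgain : #{t ∈ T | e t ≤ e j} = #{t ∈ T | e t < e j} + 1 := by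
      rw [hT.card_filter_le_eq, if_pos hj]
    beta_reduce
    rw [hgain, pow_succ, map_eq_mul_map_one, ZMod.natCast_zmod_val]
    exact mul_dvd_mul (hx j) (hψ j hj)

lemma pow_card_le_card_ker [DecidableEq ι] (hT : Spaced e T) (he : ∀ t ∈ T, 1 ≤ e t)
    (ψ : End ℤ (PiZMod p e)) (hψ : ∀ t ∈ T, (p : ZMod (p ^ e t)) ∣ entry ψ t t 1) :
    p ^ #T ≤ Nat.card ψ.ker := by
  cases nonempty_fintype ι
  have hle (i : ι) : #{t ∈ T | e t ≤ e i} ≤ e i := hT.card_filter_le_le he (e i)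
  have hlt (i : ι) : #{t ∈ T | e t < e i} ≤ e i :=
    (card_le_card (T.monotone_filter_right fun _ _ => le_of_lt)).trans (hle i)
  have hcard := card_le_card_ker_mul ψ fun x hx => map_mem_divSubmodule hT ψ hψ hx
  have hsum : ∑ i, (e i - #{t ∈ T | e t < e i}) = #T + ∑ i, (e i - #{t ∈ T | e t ≤ e i}) := by
    have hT_card : #T = ∑ i, if i ∈ T then 1 else 0 := by simp
    rw [hT_card, ← sum_add_distrib]
    refine sum_congr rfl fun i _ => ?_
    have := hle i
    rw [hT.card_filter_le_eq] at this ⊢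
    omega
  rw [card_divSubmodule hlt, card_divSubmodule hle, hsum, pow_add] at hcard
  exact Nat.le_of_mul_le_mul_right hcard (pow_pos (NeZero.pos p) _)

lemma not_dvd_entry_self [DecidableEq ι] (hp : p.Prime) {ψ : End ℤ (PiZMod p e)}
    (hψ : IsUnit ψ) {t : ι} (het : 1 ≤ e t) (ht : ∀ j, e j = e t → j = t) :
    ¬ (p : ZMod (p ^ e t)) ∣ entry ψ t t 1 := by
  intro hdvd
  cases nonempty_fintype ι
  obtain ⟨χ, hχ⟩ := hψ.exists_right_inv
  have hone : ∑ j, entry ψ t j (entry χ j t 1) = 1 := by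
    have := congrArg (· t) (LinearMap.congr_fun hχ (Pi.single t 1))
    simp only [End.mul_apply, End.one_apply, apply_eq_sum_entry ψ, Pi.single_eq_same] at this
    exact this
  have hp_dvd : (p : ZMod (p ^ e t)) ∣ 1 := by
    rw [← hone]
    refine dvd_sum fun j _ => ?_
    rcases eq_or_ne j t with rfl | hj
    · rw [map_eq_mul_map_one]
      exact hdvd.mul_left _
    · have hχj : (p : ZMod (p ^ e j)) ^ (0 + (e j - e t)) ∣ entry χ j t 1 :=
        pow_add_sub_dvd_map _ (by simp)
      refine (dvd_pow_self _ ?_).trans (pow_add_sub_dvd_map _ hχj)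
      have := mt (ht j) hj
      omega
  exact (ZMod.isUnit_prime_iff_not_dvd hp).mp (isUnit_of_dvd_one hp_dvd)
    (dvd_pow_self p (Nat.one_le_iff_ne_zero.mp het))

lemma pow_card_le_prodFix (hp : p.Prime) (hT : Spaced e T) (he : ∀ t ∈ T, 1 ≤ e t)
    (φ : PiZMod p e ≃+ PiZMod p e) : p ^ #T ≤ prodFix p φ := by
  classical
  let ψ : End ℤ (PiZMod p e) := φ.symm.toAddMonoidHom.toIntLinearMap
  have hψ : IsUnit ψ := (End.isUnit_iff ψ).mpr φ.symm.bijective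
  have hres (t : ι) : ∃ k, t ∈ T → k ∈ Icc 1 (p - 1) ∧
      (p : ZMod (p ^ e t)) ∣ entry ψ t t 1 - k := by
    by_cases ht : t ∈ T
    · obtain ⟨k, hk⟩ := exists_dvd_sub_natCast_of_not_dvd
        (not_dvd_entry_self hp hψ (he t ht) fun j => hT.eq_of_eq ht)
      exact ⟨k, fun _ => hk⟩
    · exact ⟨0, fun h => absurd h ht⟩
  choose k hk using hres
  rw [prodFix_eq_prod_card_eigenspace p φ ψ φ.symm_apply_apply,
    card_eq_sum_card_fiberwise fun t ht => (hk t ht).1, ← prod_pow_eq_pow_sum]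
  refine prod_le_prod' fun i _ => ?_
  have hfiber : Spaced e {t ∈ T | k t = i} := hT.mono (filter_subset _ _)
  rw [End.eigenspace_def]
  refine pow_card_le_card_ker hfiber (fun t ht => he t (mem_filter.mp ht).1) _ fun t ht => ?_
  obtain ⟨htT, rfl⟩ := mem_filter.mp ht
  simpa [entry] using (hk t htT).2

end LowerBound

section Construction

section End

variable {p : ℕ} {R P : Type*} [CommRing R] [AddCommGroup P] [Module R P]

lemma isNilpotent_natCast_end {N : ℕ} (hP : Nat.card P = p ^ N) : IsNilpotent (p : End R P) :=
  ⟨N, LinearMap.ext fun x => by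
    rw [← Nat.cast_pow, End.natCast_apply, ← hP, card_nsmul_eq_zero', LinearMap.zero_apply]⟩

lemma card_ker_eq_one_of_isUnit {ψ : End R P} (hψ : IsUnit ψ) : Nat.card ψ.ker = 1 := by
  rw [LinearMap.ker_eq_bot.mpr ((End.isUnit_iff ψ).mp hψ).injective, Nat.card_unique]

lemma eigenspace_natCast_eq_ker (ψ : End R P) (k : ℕ) :
    ψ.eigenspace (k : R) = LinearMap.ker (ψ - (k : End R P)) := by
  rw [End.eigenspace_def, ← Algebra.algebraMap_eq_smul_one, map_natCast]

lemma card_ker_mem_prodSpec (hp : p.Prime) (hP : IsNilpotent (p : End R P)) {ν : End R P}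
    (hν : IsNilpotent ν) : Nat.card ν.ker ∈ prodSpec p P := by
  have hone : Nat.card (End.eigenspace (1 + ν) ((1 : ℕ) : R)) = Nat.card ν.ker := by
    rw [eigenspace_natCast_eq_ker, Nat.cast_one, add_sub_cancel_left]
  rw [← hone, ← prod_eq_single (s := Icc 1 (p - 1))
    (f := fun k : ℕ => Nat.card (End.eigenspace (1 + ν) (k : R))) 1]
  · exact prod_card_eigenspace_mem_prodSpec p hν.isUnit_one_add
  · intro k hk hk1
    rw [mem_Icc] at hk
    have hunit : IsUnit ((1 : End R P) - k) := by
      simpa using isUnit_natCast_sub_natCast_of_lt (R := End R P) hp hP hp.one_lt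
        (show k < p by omega) hk1.symm
    rw [eigenspace_natCast_eq_ker, add_sub_right_comm, card_ker_eq_one_of_isUnit]
    exact hν.isUnit_add_left_of_commute hunit
      ((Commute.one_right ν).sub_right (Nat.commute_cast ν k))
  · have := hp.two_le
    exact fun h => absurd (mem_Icc.mpr ⟨le_rfl, by omega⟩) h

lemma one_mem_prodSpec_of_isUnit_sub (hp : p ≠ 0) {ψ : End R P}
    (hψ : ∀ k < p, IsUnit (ψ - (k : End R P))) : 1 ∈ prodSpec p P := by
  have hunit : IsUnit ψ := by simpa using hψ 0 (Nat.pos_of_ne_zero hp)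
  convert prod_card_eigenspace_mem_prodSpec p hunit
  refine (prod_eq_one fun k hk => ?_).symm
  rw [mem_Icc] at hk
  rw [eigenspace_natCast_eq_ker, card_ker_eq_one_of_isUnit (hψ k (by omega))]

end End

section Kernels

variable {p : ℕ} {R A B : Type*} [CommRing R] [AddCommGroup A] [AddCommGroup B] [Module R A]
  [Module R B]

lemma card_ker_comp_of_surjective [Finite A] (α : A →ₗ[R] B) {β : B →ₗ[R] A}
    (hβ : Function.Surjective β) :
    Nat.card (α ∘ₗ β).ker = Nat.card α.ker * Nat.card β.ker := by
  have hrange : (α ∘ₗ β).range = α.range := LinearMap.range_comp_of_range_eq_top α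
    (LinearMap.range_eq_top.mpr hβ)
  have : Finite α.range := Set.finite_range α
  refine Nat.eq_of_mul_eq_mul_right (Nat.card_pos (α := α.range)) ?_
  calc Nat.card (α ∘ₗ β).ker * Nat.card α.range = Nat.card B := by
        rw [← hrange, card_ker_mul_card_range]
    _ = Nat.card β.ker * Nat.card A := by
        rw [← card_ker_mul_card_range β, LinearMap.range_eq_top.mpr hβ,
          Nat.card_congr Submodule.topEquiv.toEquiv]
    _ = Nat.card α.ker * Nat.card β.ker * Nat.card α.range := by
        rw [← card_ker_mul_card_range α]
        ring

/-- The map `(x, y) ↦ (β y, α x)`. -/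
def crossMap (α : A →ₗ[R] B) (β : B →ₗ[R] A) : End R (A × B) :=
  (β ∘ₗ LinearMap.snd R A B).prod (α ∘ₗ LinearMap.fst R A B)

lemma card_ker_crossMap (α : A →ₗ[R] B) (β : B →ₗ[R] A) :
    Nat.card (crossMap α β).ker = Nat.card α.ker * Nat.card β.ker := by
  rw [← Nat.card_prod]
  refine Nat.card_congr ((Equiv.subtypeEquivRight fun x => ?_).trans Equiv.subtypeProdEquivProd)
  exact Prod.mk_eq_zero.trans and_comm

lemma crossMap_sq {α : A →ₗ[R] B} {β : B →ₗ[R] A} (hβα : ∀ x, β (α x) = p • x)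
    (hαβ : ∀ y, α (β y) = p • y) : crossMap α β ^ 2 = (p : End R (A × B)) := by
  ext x <;> simp [crossMap, sq, hβα, hαβ]

lemma card_ker_mul_card_ker_mem_prodSpec_prod (hp : p.Prime)
    (hnil : IsNilpotent (p : End R (A × B))) {α : A →ₗ[R] B} {β : B →ₗ[R] A}
    (hβα : ∀ x, β (α x) = p • x) (hαβ : ∀ y, α (β y) = p • y) :
    Nat.card α.ker * Nat.card β.ker ∈ prodSpec p (A × B) := by
  rw [← card_ker_crossMap]
  refine card_ker_mem_prodSpec hp hnil (IsNilpotent.of_pow (m := 2) ?_)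
  rwa [crossMap_sq hβα hαβ]

end Kernels

section Cyclic

variable {p : ℕ}

lemma card_ker_natCast_end_zmod (n d : ℕ) [NeZero n] :
    Nat.card (LinearMap.ker (d : End ℤ (ZMod n))) = n.gcd d := by
  rw [← Nat.card_zmod n, ← IsAddCyclic.card_nsmulAddMonoidHom_ker, Nat.card_zmod]
  rfl

lemma pow_mem_prodSpec_zmod (hp : p.Prime) {a s : ℕ} (hs : 1 ≤ s) (hsa : s ≤ a) :
    p ^ s ∈ prodSpec p (ZMod (p ^ a)) := by
  have : NeZero p := ⟨hp.ne_zero⟩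
  have hnil : IsNilpotent (p : End ℤ (ZMod (p ^ a))) :=
    isNilpotent_natCast_end (Nat.card_zmod _)
  have := card_ker_mem_prodSpec hp hnil (hnil.pow_of_pos (Nat.one_le_iff_ne_zero.mp hs))
  rwa [← Nat.cast_pow, card_ker_natCast_end_zmod, Nat.gcd_eq_right (pow_dvd_pow p hsa)] at this

lemma exists_map_castHom_eq_mul {a b : ℕ} (hab : a ≤ b) (hba : b ≤ a + 1) :
    ∃ α : ZMod (p ^ a) →ₗ[ℤ] ZMod (p ^ b),
      ∀ y, α (ZMod.castHom (pow_dvd_pow p hab) (ZMod (p ^ a)) y) = p • y := by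
  let f : ℤ →+ ZMod (p ^ b) := p • Int.castAddHom (ZMod (p ^ b))
  have hf : f (p ^ a : ℕ) = 0 := by
    have : f (p ^ a : ℕ) = ((p ^ (a + 1) : ℕ) : ZMod (p ^ b)) := by
      simp [f, pow_succ']
    rw [this, ZMod.natCast_eq_zero_iff]
    exact pow_dvd_pow p hba
  refine ⟨(ZMod.lift _ ⟨f, hf⟩).toIntLinearMap, fun y => ?_⟩
  obtain ⟨m, rfl⟩ := ZMod.intCast_surjective y
  simp [f]

lemma prime_mem_prodSpec_zmod_prod (hp : p.Prime) {a b : ℕ} (hb : 1 ≤ b) (hab : a ≤ b)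
    (hba : b ≤ a + 1) : p ∈ prodSpec p (ZMod (p ^ a) × ZMod (p ^ b)) := by
  have : NeZero p := ⟨hp.ne_zero⟩
  obtain ⟨α, hα⟩ := exists_map_castHom_eq_mul (p := p) hab hba
  let β := (ZMod.castHom (pow_dvd_pow p hab) (ZMod (p ^ a))).toAddMonoidHom.toIntLinearMap
  have hαβ (y : ZMod (p ^ b)) : α (β y) = p • y := hα y
  have hβ : Function.Surjective β := ZMod.castHom_surjective (pow_dvd_pow p hab)
  have hβα (x : ZMod (p ^ a)) : β (α x) = p • x := by
    obtain ⟨y, rfl⟩ := hβ x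
    rw [hαβ, map_nsmul]
  have hcard : Nat.card α.ker * Nat.card β.ker = p := by
    have hcomp : α ∘ₗ β = (p : End ℤ (ZMod (p ^ b))) := LinearMap.ext hαβ
    rw [← card_ker_comp_of_surjective α hβ, hcomp, card_ker_natCast_end_zmod,
      Nat.gcd_eq_right (dvd_pow_self p (by omega))]
  have hnil : IsNilpotent (p : End ℤ (ZMod (p ^ a) × ZMod (p ^ b))) :=
    isNilpotent_natCast_end (N := a + b) (by simp [pow_add])
  have hmem := card_ker_mul_card_ker_mem_prodSpec_prod hp hnil hβα hαβ
  rwa [hcard] at hmem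

end Cyclic

section Companion

open Polynomial

lemma one_mem_prodSpec_of_isUnit_sub_natCast {p : ℕ} (hp : p ≠ 0) {S : Type*} [CommRing S] {s : S}
    (hs : ∀ k < p, IsUnit (s - k)) : 1 ∈ prodSpec p S :=
  one_mem_prodSpec_of_isUnit_sub hp (ψ := Algebra.lmul ℤ S s) fun k hk => by
    rw [← map_natCast (Algebra.lmul ℤ S), ← map_sub]
    exact (hs k hk).map _

lemma isUnit_root_sub_of {R : Type*} [CommRing R] {f : R[X]} {r : R} (h : IsUnit (f.eval r)) :
    IsUnit (AdjoinRoot.root f - AdjoinRoot.of f r) := by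
  have hdvd := sub_dvd_eval_sub (AdjoinRoot.root f) (AdjoinRoot.of f r) (f.map (AdjoinRoot.of f))
  rw [eval_map, AdjoinRoot.eval₂_root, eval_map, eval₂_at_apply, zero_sub] at hdvd
  exact isUnit_of_dvd_unit hdvd (h.map (AdjoinRoot.of f)).neg

lemma exists_forall_not_dvd_pow_sub_pow {p d : ℕ} (hp : p.Prime) (hd : 2 ≤ d) :
    ∃ u : ℤ, ∀ k : ℤ, ¬ (p : ℤ) ∣ k ^ d - k ^ (d - 1) - u := by
  have : Fact p.Prime := ⟨hp⟩
  let f : ZMod p → ZMod p := fun x => x ^ d - x ^ (d - 1)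
  have hf : ¬ Function.Surjective f := fun hsurj => by
    have h01 : f 0 = f 1 := by simp [f, show d ≠ 0 by omega, show d - 1 ≠ 0 by omega]
    exact zero_ne_one (Finite.injective_iff_surjective.mpr hsurj h01)
  obtain ⟨v, hv⟩ := not_forall.mp hf
  obtain ⟨u, rfl⟩ := ZMod.intCast_surjective v
  refine ⟨u, fun k hk => hv ⟨k, ?_⟩⟩
  rw [← ZMod.intCast_zmod_eq_zero_iff_dvd] at hk
  push_cast at hk
  exact sub_eq_zero.mp hk

/- Multiplication by a root of a monic polynomial `f` of degree `#ι`, in the free algebra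
`R[X] / (f)`, has no eigenvalue `k` when `f k` is a unit; for `f = X ^ d - X ^ (d - 1) - u` the
values `f k` avoid the multiples of `p` for a suitable `u`. -/
lemma one_mem_prodSpec_pi {p : ℕ} (hp : p.Prime) {R : Type*} [CommRing R] [Nontrivial R]
    (hR : IsNilpotent (p : R)) {ι : Type*} [Fintype ι] (hι : 2 ≤ Fintype.card ι) :
    1 ∈ prodSpec p (ι → R) := by
  set d := Fintype.card ι with hd
  obtain ⟨u, hu⟩ := exists_forall_not_dvd_pow_sub_pow hp hι
  let f : R[X] := X ^ d - X ^ (d - 1) - C (u : R)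
  have hd0 : d ≠ 0 := by omega
  have hd1 : d ≠ d - 1 := by omega
  have hdeg : f.natDegree = d := by
    unfold f
    compute_degree!
    simp [hd1, hd0]
  have hmonic : f.Monic := by
    unfold f
    monicity!
    simp [hd1, hd0]
  have hunit (k : ℕ) (_ : k < p) : IsUnit (AdjoinRoot.root f - k) := by
    rw [← map_natCast (AdjoinRoot.of f)]
    refine isUnit_root_sub_of ?_
    simpa [f] using isUnit_intCast_of_isNilpotent hp hR (hu k)
  let b := (AdjoinRoot.powerBasis' hmonic).basis.reindex
    (Fintype.equivFinOfCardEq (hd.symm.trans hdeg.symm)).symm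
  rw [← prodSpec_congr p b.equivFun.toAddEquiv]
  exact one_mem_prodSpec_of_isUnit_sub_natCast hp.ne_zero hunit

end Companion

end Construction

section Assembly

variable {p : ℕ} {ι : Type*} {e : ι → ℕ}

/-- The direct summand of `⨁ᵢ ℤ / p ^ eᵢ ℤ` spanned by the coordinates in `s`. -/
abbrev Factor (p : ℕ) {ι : Type*} (e : ι → ℕ) (s : Finset ι) : Type _ :=
  PiZMod p fun i : s => e i

/-- Every power of `p` with exponent in the nonempty interval `[a, ∑ i ∈ s, e i]` is a value of `Π`
on the summand attached to `s`. -/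
def Realizes (p : ℕ) {ι : Type*} (e : ι → ℕ) (s : Finset ι) (a : ℕ) : Prop :=
  a ≤ ∑ i ∈ s, e i ∧ ∀ m ∈ Icc a (∑ i ∈ s, e i), p ^ m ∈ prodSpec p (Factor p e s)

lemma Realizes.of_succ {s : Finset ι} {a : ℕ} (h : Realizes p e s (a + 1))
    (ha : p ^ a ∈ prodSpec p (Factor p e s)) : Realizes p e s a := by
  refine ⟨(Nat.le_succ a).trans h.1, fun m hm => ?_⟩
  obtain ⟨ham, hme⟩ := mem_Icc.mp hm
  rcases ham.eq_or_lt with rfl | ham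
  · exact ha
  · exact h.2 m (mem_Icc.mpr ⟨ham, hme⟩)

lemma realizes_empty : Realizes p e ∅ 0 := by
  refine ⟨Nat.zero_le _, fun m hm => ?_⟩
  obtain rfl : m = 0 := by simpa using hm
  refine ⟨AddEquiv.refl _, prod_eq_one fun k _ => ?_⟩
  exact Nat.card_eq_one_iff_unique.mpr ⟨inferInstance, ⟨0, map_zero _⟩⟩

lemma realizes_singleton (hp : p.Prime) {k : ι} (hk : 1 ≤ e k) : Realizes p e {k} 1 := by
  rw [Realizes, sum_singleton]
  refine ⟨hk, fun m hm => ?_⟩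
  obtain ⟨h1m, hmk⟩ := mem_Icc.mp hm
  rw [prodSpec_congr p (AddEquiv.piUnique fun i : ({k} : Finset ι) => ZMod (p ^ e i))]
  exact pow_mem_prodSpec_zmod hp h1m hmk

/-- The summand attached to all coordinates is the whole group. -/
def factorUnivEquiv (p : ℕ) {ι : Type*} [Fintype ι] (e : ι → ℕ) :
    Factor p e univ ≃+ PiZMod p e where
  toFun x i := x ⟨i, mem_univ i⟩
  invFun x i := x i
  left_inv _ := rfl
  right_inv _ := rfl
  map_add' _ _ := rfl

section Union

variable [DecidableEq ι]

/-- A decomposition of the index set into two parts decomposes the group. -/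
def factorUnionEquiv {s t : Finset ι} (h : Disjoint s t) :
    Factor p e s × Factor p e t ≃+ Factor p e (s ∪ t) where
  toEquiv := Equiv.piFinsetUnion (fun i => ZMod (p ^ e i)) h
  map_add' x y := by
    ext ⟨i, hi⟩
    rcases mem_union.mp hi with his | hit
    · simp [Equiv.piFinsetUnion_left _ h his]
    · simp [Equiv.piFinsetUnion_right _ h hit]

lemma mul_mem_prodSpec_factor_union {s t : Finset ι} (h : Disjoint s t) {a b : ℕ}
    (ha : a ∈ prodSpec p (Factor p e s)) (hb : b ∈ prodSpec p (Factor p e t)) :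
    a * b ∈ prodSpec p (Factor p e (s ∪ t)) :=
  prodSpec_congr p (factorUnionEquiv h) ▸ mul_mem_prodSpec_prod p ha hb

lemma Realizes.union {s t : Finset ι} {a b : ℕ} (hs : Realizes p e s a) (ht : Realizes p e t b)
    (h : Disjoint s t) : Realizes p e (s ∪ t) (a + b) := by
  have has := hs.1
  have hbt := ht.1
  rw [Realizes, sum_union h]
  refine ⟨add_le_add has hbt, fun m hm => ?_⟩
  rw [mem_Icc] at hm
  obtain ⟨c, d, rfl, hc, hd⟩ :
      ∃ c d, m = c + d ∧ c ∈ Icc a (∑ i ∈ s, e i) ∧ d ∈ Icc b (∑ i ∈ t, e i) := by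
    refine ⟨min (∑ i ∈ s, e i) (m - b), m - min (∑ i ∈ s, e i) (m - b), ?_, ?_, ?_⟩
    · omega
    · rw [mem_Icc]
      omega
    · rw [mem_Icc]
      omega
  rw [pow_add]
  exact mul_mem_prodSpec_factor_union h (hs.2 c hc) (ht.2 d hd)

lemma Realizes.biUnion {κ : Type*} {I : Finset κ} {s : κ → Finset ι} {a : κ → ℕ}
    (h : ∀ i ∈ I, Realizes p e (s i) (a i)) (hd : (I : Set κ).PairwiseDisjoint s) :
    Realizes p e (I.biUnion s) (∑ i ∈ I, a i) := by
  classical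
  induction I using Finset.induction_on with
  | empty => exact realizes_empty
  | insert i I hi ih =>
    rw [coe_insert, Set.pairwiseDisjoint_insert_of_notMem (mod_cast hi)] at hd
    rw [biUnion_insert, sum_insert hi]
    exact (h i (mem_insert_self i I)).union
      (ih (fun j hj => h j (mem_insert_of_mem hj)) hd.1)
      ((disjoint_biUnion_right ..).mpr hd.2)

lemma realizes_pair (hp : p.Prime) {k l : ι} (hkl : k ≠ l) (hk : 1 ≤ e k) (hle : e k ≤ e l)
    (hlk : e l ≤ e k + 1) : Realizes p e {k, l} 1 := by
  have hdisj : Disjoint ({k} : Finset ι) {l} := disjoint_singleton.mpr hkl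
  refine ((realizes_singleton hp hk).union (realizes_singleton hp (hk.trans hle)) hdisj).of_succ ?_
  rw [pow_one, ← prodSpec_congr p (factorUnionEquiv hdisj),
    prodSpec_congr p ((AddEquiv.piUnique fun i : ({k} : Finset ι) => ZMod (p ^ e i)).prodCongr
      (AddEquiv.piUnique fun i : ({l} : Finset ι) => ZMod (p ^ e i)))]
  exact prime_mem_prodSpec_zmod_prod hp (hk.trans hle) hle hlk

end Union

lemma one_mem_prodSpec_factor_of_const (hp : p.Prime) {s : Finset ι} {v : ℕ} (hv : 1 ≤ v)
    (hs : ∀ i ∈ s, e i = v) (hcard : 2 ≤ #s) : 1 ∈ prodSpec p (Factor p e s) := by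
  have : Fact (1 < p ^ v) := ⟨Nat.one_lt_pow (by omega) hp.one_lt⟩
  have hnil : IsNilpotent (p : ZMod (p ^ v)) := ⟨v, by rw [← Nat.cast_pow, ZMod.natCast_self]⟩
  rw [prodSpec_congr p (AddEquiv.piCongrRight fun i : s =>
    (ZMod.ringEquivCongr (congrArg (p ^ ·) (hs i i.2))).toAddEquiv)]
  exact one_mem_prodSpec_pi hp hnil (by rwa [Fintype.card_coe])

lemma realizes_zero_of_const (hp : p.Prime) {s : Finset ι} {v : ℕ} (hv : 1 ≤ v)
    (hs : ∀ i ∈ s, e i = v) (hcard : 2 ≤ #s) : Realizes p e s 0 := by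
  classical
  refine Realizes.of_succ ?_ (by simpa using one_mem_prodSpec_factor_of_const hp hv hs hcard)
  induction s using Finset.induction_on with
  | empty => simp at hcard
  | insert k t hk ih =>
    have hkv : e k = v := hs k (mem_insert_self k t)
    have ht (i : ι) (hi : i ∈ t) : e i = v := hs i (mem_insert_of_mem hi)
    rw [card_insert_of_notMem hk] at hcard
    rcases (show 1 ≤ #t by omega).eq_or_lt with hone | htwo
    · obtain ⟨l, rfl⟩ := card_eq_one.mp hone.symm
      have hlv := ht l (mem_singleton_self l)
      exact realizes_pair hp (notMem_singleton.mp hk) (by omega) (by omega) (by omega)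
    · have hzero : Realizes p e t 0 :=
        (ih ht htwo).of_succ (by simpa using one_mem_prodSpec_factor_of_const hp hv ht htwo)
      exact (realizes_singleton hp (by omega)).union hzero (disjoint_singleton_left.mpr hk)

lemma realizes_zero_of_forall_exists_eq (hp : p.Prime) {s : Finset ι} (he : ∀ i ∈ s, 1 ≤ e i)
    (hs : ∀ i ∈ s, ∃ j ∈ s, j ≠ i ∧ e j = e i) : Realizes p e s 0 := by
  classical
  rw [← image_biUnion_filter_eq s e, ← sum_const_zero]
  refine Realizes.biUnion (fun v hv => ?_) (Set.pairwiseDisjoint_filter e _ s)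
  obtain ⟨i, hi, rfl⟩ := mem_image.mp hv
  obtain ⟨j, hj, hji, heq⟩ := hs i hi
  exact realizes_zero_of_const hp (he i hi) (fun k hk => (mem_filter.mp hk).2)
    (one_lt_card.mpr ⟨j, mem_filter.mpr ⟨hj, heq⟩, i, mem_filter.mpr ⟨hi, rfl⟩, hji⟩)

end Assembly

section Blocks

variable {p n : ℕ} {e : Fin n → ℕ}

lemma IsBStart.isBCandidate {k : ℕ} (h : IsBStart e k) : IsBCandidate e k := by
  cases k with
  | zero => exact h
  | succ k => exact h.1

lemma IsBStart.not_succ {k : ℕ} (h : IsBStart e k) : ¬ IsBStart e (k + 1) := fun h' => h'.2 h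

lemma InB.not_inA {i : Fin n} (h : InB e i) : ¬ InA e i := by
  rcases h with h | ⟨k, hk, h⟩
  · exact h.isBCandidate.2.1
  · obtain ⟨hkn, -, hA, -⟩ := h.isBCandidate
    rwa [show i = ⟨k + 1, hkn⟩ from Fin.ext hk.symm]

lemma IsBCandidate.inB {i : Fin n} (h : IsBCandidate e i) : InB e i := by
  obtain ⟨k, hk⟩ := i
  cases k with
  | zero => exact Or.inl h
  | succ k =>
    by_cases hs : IsBStart e k
    · exact Or.inr ⟨k, rfl, hs⟩
    · exact Or.inl ⟨h, hs⟩

lemma val_eq_succ_of_eq_succ (hm : Monotone e) {j t : Fin n} (hj : ¬ InA e j) (ht : ¬ InA e t)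
    (h : e t = e j + 1) : (t : ℕ) = j + 1 := by
  have hjt : j < t := hm.reflect_lt (by omega)
  by_contra hne
  let i : Fin n := ⟨j + 1, by omega⟩
  have hji : j < i := Fin.lt_def.mpr (Nat.lt_succ_self _)
  have hit : i < t := Fin.lt_def.mpr (by change (j : ℕ) + 1 < t; omega)
  have hj_ne : e i ≠ e j := fun heq => hj ⟨i, hji.ne', heq⟩
  have ht_ne : e i ≠ e t := fun heq => ht ⟨i, hit.ne, heq⟩
  have := hm hji.le
  have := hm hit.le
  omega

lemma isBCandidate_of_eq_succ (hm : Monotone e) {j t : Fin n} (hj : ¬ InA e j) (ht : ¬ InA e t)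
    (h : e t = e j + 1) : IsBCandidate e j := by
  have hjt := val_eq_succ_of_eq_succ hm hj ht h
  have hjn : (j : ℕ) + 1 < n := hjt ▸ t.2
  obtain rfl : ⟨j + 1, hjn⟩ = t := Fin.ext hjt.symm
  exact ⟨hjn, hj, ht, h⟩

open Classical in
/-- The first entries of the `b`-blocks. -/
noncomputable def bStarts (e : Fin n → ℕ) : Finset (Fin n) := {i | IsBStart e i}

open Classical in
/-- The entries of the `c`-blocks. -/
noncomputable def cEntries (e : Fin n → ℕ) : Finset (Fin n) := {i | ¬ InA e i ∧ ¬ InB e i}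

@[simp] lemma mem_bStarts {i : Fin n} : i ∈ bStarts e ↔ IsBStart e i := by simp [bStarts]

@[simp] lemma mem_cEntries {i : Fin n} : i ∈ cEntries e ↔ ¬ InA e i ∧ ¬ InB e i := by
  simp [cEntries]

lemma card_bStarts (e : Fin n → ℕ) : #(bStarts e) = bCount e :=
  (Nat.subtype_card _ fun _ => mem_bStarts).symm

lemma card_cEntries (e : Fin n → ℕ) : #(cEntries e) = cCount e :=
  (Nat.subtype_card _ fun _ => mem_cEntries).symm

lemma disjoint_bStarts_cEntries (e : Fin n → ℕ) : Disjoint (bStarts e) (cEntries e) :=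
  disjoint_left.mpr fun _ hb hc => (mem_cEntries.mp hc).2 (Or.inl (mem_bStarts.mp hb))

lemma card_bStarts_union_cEntries (e : Fin n → ℕ) :
    #(bStarts e ∪ cEntries e) = bCount e + cCount e := by
  rw [card_union_of_disjoint (disjoint_bStarts_cEntries e), card_bStarts, card_cEntries]

lemma spaced_bStarts_union_cEntries (hm : Monotone e) : Spaced e (bStarts e ∪ cEntries e) := by
  have hA {t : Fin n} (ht : t ∈ bStarts e ∪ cEntries e) : ¬ InA e t := by
    rcases mem_union.mp ht with h | h
    · exact InB.not_inA (Or.inl (mem_bStarts.mp h))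
    · exact (mem_cEntries.mp h).1
  refine ⟨fun j t ht h => by_contra fun hj => hA ht ⟨j, hj, h⟩, fun t j ht hj h => ?_⟩
  have hj_start : IsBStart e j := by
    rcases mem_union.mp hj with hb | hc
    · exact mem_bStarts.mp hb
    · exact absurd (isBCandidate_of_eq_succ hm (hA hj) (hA ht) h).inB (mem_cEntries.mp hc).2
  have htj := val_eq_succ_of_eq_succ hm (hA hj) (hA ht) h
  rcases mem_union.mp ht with hb | hc
  · exact hj_start.not_succ (htj ▸ mem_bStarts.mp hb)
  · exact (mem_cEntries.mp hc).2 (Or.inr ⟨j, htj.symm, hj_start⟩)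

/-- The positions `k` and `k + 1`: the `b`-block that starts at `k`. -/
def pairAt (k : Fin n) : Finset (Fin n) := {i | i = k ∨ (i : ℕ) = k + 1}

@[simp] lemma mem_pairAt {i k : Fin n} : i ∈ pairAt k ↔ i = k ∨ (i : ℕ) = k + 1 := by
  simp [pairAt]

lemma realizes_pairAt (hp : p.Prime) (he : ∀ i, 1 ≤ e i) {k : Fin n} (h : IsBStart e k) :
    Realizes p e (pairAt k) 1 := by
  obtain ⟨hkn, -, -, hsucc⟩ := h.isBCandidate
  have hpair : pairAt k = {k, ⟨k + 1, hkn⟩} := by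
    ext i
    simp [Fin.ext_iff]
  rw [hpair]
  exact realizes_pair hp (by simp [Fin.ext_iff]) (he k) (hsucc ▸ Nat.le_succ _) hsucc.le

lemma pairwiseDisjoint_pairAt (e : Fin n → ℕ) :
    (bStarts e : Set (Fin n)).PairwiseDisjoint pairAt := by
  intro k hk l hl hkl
  rw [mem_coe, mem_bStarts] at hk hl
  refine disjoint_left.mpr fun i hik hil => ?_
  rw [mem_pairAt] at hik hil
  rcases hik with rfl | hik <;> rcases hil with rfl | hil
  · exact hkl rfl
  · exact hl.not_succ (hil ▸ hk)
  · exact hk.not_succ (hik ▸ hl)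
  · exact hkl (Fin.ext (by omega))

lemma mem_biUnion_pairAt {i : Fin n} : i ∈ (bStarts e).biUnion pairAt ↔ InB e i := by
  simp only [mem_biUnion, mem_bStarts, mem_pairAt]
  constructor
  · rintro ⟨k, hk, rfl | h⟩
    · exact Or.inl hk
    · exact Or.inr ⟨k, h.symm, hk⟩
  · rintro (h | ⟨k, hk, h⟩)
    · exact ⟨i, h, Or.inl rfl⟩
    · exact ⟨⟨k, by omega⟩, h, Or.inr hk.symm⟩

lemma realizes_biUnion_pairAt (hp : p.Prime) (he : ∀ i, 1 ≤ e i) :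
    Realizes p e ((bStarts e).biUnion pairAt) (bCount e) := by
  rw [← card_bStarts, card_eq_sum_ones]
  exact Realizes.biUnion (fun k hk => realizes_pairAt hp he (mem_bStarts.mp hk))
    (pairwiseDisjoint_pairAt e)

lemma realizes_cEntries (hp : p.Prime) (he : ∀ i, 1 ≤ e i) :
    Realizes p e (cEntries e) (cCount e) := by
  rw [← card_cEntries, card_eq_sum_ones]
  nth_rw 1 [← biUnion_singleton_eq_self (s := cEntries e)]
  exact Realizes.biUnion (fun k _ => realizes_singleton hp (he k))
    fun _ _ _ _ h => disjoint_singleton.mpr h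

open Classical in
lemma realizes_filter_inA (hp : p.Prime) (he : ∀ i, 1 ≤ e i) :
    Realizes p e {i | InA e i} 0 := by
  refine realizes_zero_of_forall_exists_eq hp (fun i _ => he i) fun i hi => ?_
  obtain ⟨j, hji, heq⟩ := (mem_filter.mp hi).2
  exact ⟨j, by simpa using ⟨i, hji.symm, heq.symm⟩, hji, heq⟩

lemma realizes_univ (hp : p.Prime) (he : ∀ i, 1 ≤ e i) :
    Realizes p e univ (bCount e + cCount e) := by
  classical
  have hAB : Disjoint ({i | InA e i} : Finset (Fin n)) ((bStarts e).biUnion pairAt) :=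
    disjoint_left.mpr fun i hA hB => (mem_biUnion_pairAt.mp hB).not_inA (mem_filter.mp hA).2
  have hABC : Disjoint (({i | InA e i} : Finset (Fin n)) ∪ (bStarts e).biUnion pairAt)
      (cEntries e) := by
    simp only [disjoint_left, mem_union, mem_filter_univ, mem_biUnion_pairAt, mem_cEntries]
    tauto
  have hunion : ({i | InA e i} : Finset (Fin n)) ∪ (bStarts e).biUnion pairAt ∪ cEntries e =
      univ := by
    simp only [eq_univ_iff_forall, mem_union, mem_filter_univ, mem_biUnion_pairAt, mem_cEntries]
    tauto
  have h := ((realizes_filter_inA hp he).union (realizes_biUnion_pairAt hp he) hAB).union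
    (realizes_cEntries hp he) hABC
  rwa [hunion, zero_add] at h

end Blocks

end AbelianPGroup

open AbelianPGroup in
theorem mainTheorem2 (p : ℕ) (hp : p.Prime) {n : ℕ} (e : Fin n → ℕ)
    (P : Type*) [AddCommGroup P] (hP : AbelianPGroup.IsOfType p e P) :
    AbelianPGroup.prodSpec p P =
      {N : ℕ | ∃ m : ℕ, AbelianPGroup.bCount e + AbelianPGroup.cCount e ≤ m ∧
        m ≤ ∑ i, e i ∧ N = p ^ m} := by
  obtain ⟨⟨he, hm⟩, ⟨g⟩⟩ := hP
  have : NeZero p := ⟨hp.ne_zero⟩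
  rw [prodSpec_congr p g]
  refine Set.Subset.antisymm ?_ ?_
  · rintro _ ⟨φ, rfl⟩
    have hcard := card_piZMod p e
    have hdvd : prodFix p φ ∣ p ^ ∑ i, e i := hcard ▸ prodFix_dvd_card hp hcard φ
    obtain ⟨m, hm_le, hφ⟩ := (Nat.dvd_prime_pow hp).mp hdvd
    have hle := pow_card_le_prodFix hp (spaced_bStarts_union_cEntries hm) (fun t _ => he t) φ
    rw [card_bStarts_union_cEntries, hφ, Nat.pow_le_pow_iff_right hp.one_lt] at hle
    exact ⟨m, hle, hm_le, hφ⟩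
  · rintro _ ⟨m, hle, hm_le, rfl⟩
    rw [← prodSpec_congr p (factorUnivEquiv p e)]
    exact (realizes_univ hp he).2 m (Finset.mem_Icc.mpr ⟨hle, hm_le⟩)
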